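/- Let $K$ be a quadratic field with field embeddings $\alpha\mapsto\alpha_\infty$ of $K$ into $\mathbb{R}$ and $\alpha\mapsto\alpha_{\langle 2\rangle}$ of $K$ into $\mathbb{Q}_2$. For $u=\sum_{n\in\mathbb{Z}}c_n2^n\in\mathbb{Q}_2$ with $c_n\in\{0,1\}$ and $c_n=0$ for $n<v_2(u)$, put $\lfloor u\rfloor_2:=\sum_{n\le 0}c_n2^n\in\mathbb{Q}$. For $s\in\{1,2\}$ and $\alpha\in K$, let $m_s(\alpha)$ be the smallest among the integers $i$ for which $|\alpha_\infty-is-\lfloor\alpha_{\langle 2\rangle}\rfloor_2|$ attains its minimum over $i\in\mathbb{Z}$. Put $$b^{(0)}(\alpha):=2m_2(\alpha)+\lfloor\alpha_{\langle 2\rangle}\rfloor_2,\qquad b^{(1)}(\alpha):=m_1(\alpha)+\lfloor\alpha_{\langle 2\rangle}\rfloor_2,$$ and for $\varepsilon\in\{0,1\}$ $$T_{2,\varepsilon}(\alpha):=\frac1\alpha-b^{(\varepsilon)}\!\left(\frac1\alpha\right)\ (\alpha\ne0),\qquad F_{2,\varepsilon}(\alpha):=\frac{1}{\alpha-b^{(\varepsilon)}(\alpha)}\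 (\alpha\neq b^{(\varepsilon)}(\alpha)).$$ (1) Let $\alpha\in K\setminus\mathbb{Q}$ have property $I$, that is, $\alpha_\infty\in(-1,1]$ and $v_2(\alpha_{\langle 2\rangle})>0$. Define $\alpha_{(1)}:=\alpha$ and, as long as $\alpha_{(n)}\ne0$, $\alpha_{(n+1)}:=T_{2,0}(\alpha_{(n)})$ for even $n\ge1$ and $\alpha_{(n+1)}:=T_{2,1}(\alpha_{(n)})$ for odd $n\geq 1$; the sequence terminates if $\alpha_{(n)}=0$. Then there exist integers $1\le n_1<n_2$ with $n_1\equiv n_2\pmod 2$ such that $\alpha_{(n_1)}$ and $\alpha_{(n_2)}$ are defined and $\alpha_{(n_1)}=\alpha_{(n_2)}$. (2) Let $\alpha\in K\setminus\mathbb{Q}$. Define $\alpha_0:=\alpha$ and, as long as the right-hand side is defined, $\alpha_{n+1}:=F_{2,0}(\alpha_n)$ for even $n\ge0$ and $\alpha_{n+1}:=F_{2,1}(\alpha_n)$ for odd $n\ge 0$. Then there exist integers $0\le n_1<n_2$ with $n_1\equiv n_2\pmod 2$ such that $\alpha_{n_1}$ and $\alpha_{n_2}$ are defined and $\alpha_{n_1}=\alpha_{n_2}$.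 -/

import Mathlib

namespace PadicRealCF

/-! ### `p`-adic expansions and the `p`-adic floor -/

section Digits

variable (p : ℕ) [Fact p.Prime]

/-- `p ^ (-v_p(x)) * x` is a `p`-adic integer. -/
theorem norm_mul_zpow_neg_valuation_le (x : ℚ_[p]) :
    ‖x * (p : ℚ_[p]) ^ (-x.valuation)‖ ≤ 1 := by
  have hp : (0 : ℝ) < p := by exact_mod_cast (Fact.out : p.Prime).pos
  rcases eq_or_ne x 0 with rfl | hx
  · simp
  · rw [norm_mul, Padic.norm_p_zpow, Padic.norm_eq_zpow_neg_valuation hx, ← zpow_add₀ hp.ne']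
    simp

/-- `p ^ (-v_p(x)) * x` as an element of `ℤ_[p]` (it is `0` for `x = 0`). -/
noncomputable def unitPart (x : ℚ_[p]) : ℤ_[p] :=
  ⟨x * (p : ℚ_[p]) ^ (-x.valuation), norm_mul_zpow_neg_valuation_le p x⟩

/-- The `k`-th digit of a `p`-adic integer `u` in base `p`, with digits in `{0, …, p - 1}`.
Here `u.appr k` is the residue of `u` modulo `p ^ k` in `{0, …, p ^ k - 1}`. -/
noncomputable def intDigit (u : ℤ_[p]) (k : ℕ) : ℕ :=
  (u.appr (k + 1) - u.appr k) / p ^ k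

/-- The digit `c_n` in the expansion `x = ∑_{n ∈ ℤ} c_n p ^ n`, `c_n ∈ {0, …, p - 1}`,
of a `p`-adic number `x`, where `c_n = 0` for `n < v_p(x)`. -/
noncomputable def digit (x : ℚ_[p]) (n : ℤ) : ℕ :=
  if n < x.valuation then 0 else intDigit p (unitPart p x) (n - x.valuation).toNat

/-- The `p`-adic floor `⌊x⌋_p = ∑_{n ≤ 0} c_n p ^ n`, a rational number. -/
noncomputable def padicFloor (x : ℚ_[p]) : ℚ :=
  ∑ n ∈ Finset.Icc x.valuation 0, (digit p x n : ℚ) * (p : ℚ) ^ n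

theorem intDigit_mul_pow (u : ℤ_[p]) (k : ℕ) :
    intDigit p u k * p ^ k = u.appr (k + 1) - u.appr k :=
  Nat.div_mul_cancel (PadicInt.dvd_appr_sub_appr u k (k + 1) k.le_succ)

theorem intDigit_lt (u : ℤ_[p]) (k : ℕ) : intDigit p u k < p := by
  have hp : 0 < p := (Fact.out : p.Prime).pos
  rw [intDigit, Nat.div_lt_iff_lt_mul (pow_pos hp k)]
  have := PadicInt.appr_lt u (k + 1)
  rw [pow_succ'] at this
  omega

theorem digit_lt (x : ℚ_[p]) (n : ℤ) : digit p x n < p := by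
  unfold digit
  split_ifs
  · exact (Fact.out : p.Prime).pos
  · exact intDigit_lt p _ _

theorem sum_intDigit (u : ℤ_[p]) (k : ℕ) :
    ∑ i ∈ Finset.range k, intDigit p u i * p ^ i = u.appr k := by
  induction k with
  | zero => simp [PadicInt.appr]
  | succ k ih =>
    rw [Finset.sum_range_succ, ih, intDigit_mul_pow]
    have := PadicInt.appr_mono u k.le_succ
    simp only [Nat.succ_eq_add_one] at this
    omega

/-- `digit` is the expansion: the series `∑_{n ∈ ℤ} c_n p ^ n` converges to `x`. -/
theorem hasSum_digit (x : ℚ_[p]) :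
    HasSum (fun n : ℤ => (digit p x n : ℚ_[p]) * (p : ℚ_[p]) ^ n) x := by
  have hp1 : 1 < p := (Fact.out : p.Prime).one_lt
  have hpR : (1 : ℝ) < p := by exact_mod_cast hp1
  have hp0 : (p : ℚ_[p]) ≠ 0 := by exact_mod_cast (by omega : p ≠ 0)
  set u := unitPart p x with hu
  have hux : (u : ℚ_[p]) * (p : ℚ_[p]) ^ x.valuation = x := by
    rw [hu]
    simp only [unitPart]
    rw [mul_assoc, ← zpow_add₀ hp0]
    simp
  have hsum : Summable fun k : ℕ => (intDigit p u k : ℚ_[p]) * (p : ℚ_[p]) ^ k := by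
    refine Summable.of_norm_bounded (g := fun k : ℕ => ((p : ℝ)⁻¹) ^ k)
      (summable_geometric_of_lt_one (by positivity) (inv_lt_one_of_one_lt₀ hpR)) fun k => ?_
    rw [norm_mul, norm_pow, Padic.norm_p]
    have h1 : ‖((intDigit p u k : ℕ) : ℚ_[p])‖ ≤ 1 := by
      exact_mod_cast Padic.norm_int_le_one (p := p) (intDigit p u k : ℤ)
    have h2 : (0 : ℝ) ≤ (p : ℝ)⁻¹ ^ k := by positivity
    nlinarith
  have hNat : HasSum (fun k : ℕ => (intDigit p u k : ℚ_[p]) * (p : ℚ_[p]) ^ k) u := by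
    rw [hsum.hasSum_iff_tendsto_nat]
    have hpart : ∀ k : ℕ, ∑ i ∈ Finset.range k, (intDigit p u i : ℚ_[p]) * (p : ℚ_[p]) ^ i
        = (u.appr k : ℚ_[p]) := fun k => by
      rw [← sum_intDigit p u k]
      push_cast
      rfl
    simp only [hpart]
    rw [tendsto_iff_norm_sub_tendsto_zero]
    refine squeeze_zero (fun _ => norm_nonneg _) (fun k => ?_)
      (tendsto_pow_atTop_nhds_zero_of_lt_one (r := (p : ℝ)⁻¹) (by positivity)
        (inv_lt_one_of_one_lt₀ hpR))
    have h := (PadicInt.norm_le_pow_iff_mem_span_pow (u - (u.appr k : ℤ_[p])) k).2 (PadicInt.appr_spec k u)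
    rw [norm_sub_rev]
    have h' : ‖(u : ℚ_[p]) - (u.appr k : ℚ_[p])‖ = ‖u - (u.appr k : ℤ_[p])‖ := by
      rw [PadicInt.norm_def]
      push_cast
      rfl
    rw [h']
    simpa using h
  have hmul := hNat.mul_right ((p : ℚ_[p]) ^ x.valuation)
  rw [hux] at hmul
  have hinj : Function.Injective fun k : ℕ => x.valuation + (k : ℤ) := fun a b h => by
    simpa using h
  have hcomp : (fun k : ℕ => (intDigit p u k : ℚ_[p]) * (p : ℚ_[p]) ^ k
      * (p : ℚ_[p]) ^ x.valuation)
      = (fun n : ℤ => (digit p x n : ℚ_[p]) * (p : ℚ_[p]) ^ n)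
        ∘ fun k : ℕ => x.valuation + (k : ℤ) := by
    funext k
    have h1 : ¬ x.valuation + (k : ℤ) < x.valuation := by omega
    simp only [Function.comp, digit, h1, if_false, add_sub_cancel_left, Int.toNat_natCast, ← hu]
    rw [zpow_add₀ hp0, zpow_natCast]
    ring
  rw [hcomp] at hmul
  refine (hinj.hasSum_iff ?_).1 hmul
  intro n hn
  have : n < x.valuation := by
    by_contra hlt
    exact hn ⟨(n - x.valuation).toNat, by simp only; omega⟩
  simp [digit, this]

end Digits

/-! ### The nearest multiple -/

/-- Among the integers `i` for which `|y - i * s|` attains its minimum, the smallest one. -/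
noncomputable def nearest (y : ℝ) (s : ℕ) : ℤ :=
  sInf {i : ℤ | ∀ j : ℤ, |y - i * s| ≤ |y - j * s|}

theorem isLeast_nearest (y : ℝ) {s : ℕ} (hs : 0 < s) :
    IsLeast {i : ℤ | ∀ j : ℤ, |y - i * s| ≤ |y - j * s|} (nearest y s) := by
  have hs' : (0 : ℝ) < s := by exact_mod_cast hs
  have hne : {i : ℤ | ∀ j : ℤ, |y - i * s| ≤ |y - j * s|}.Nonempty := by
    refine ⟨round (y / s), fun j => ?_⟩
    have h := round_le (y / s) j
    have e : ∀ i : ℤ, |y - i * s| = |y / s - i| * s := fun i => by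
      rw [show y - i * s = (y / s - i) * s by rw [sub_mul, div_mul_cancel₀ _ hs'.ne'],
        abs_mul, abs_of_pos hs']
    rw [e, e]
    exact mul_le_mul_of_nonneg_right h hs'.le
  have hbdd : BddBelow {i : ℤ | ∀ j : ℤ, |y - i * s| ≤ |y - j * s|} := by
    refine ⟨⌊y / s⌋ - 1, fun i hi => ?_⟩
    by_contra hlt
    have h1 : (i : ℝ) ≤ ⌊y / s⌋ - 2 := by exact_mod_cast (by omega : i ≤ ⌊y / s⌋ - 2)
    have h2 := Int.floor_le (y / s)
    have h3 : (i + 1 : ℝ) * s ≤ y := by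
      rw [← le_div_iff₀ hs']
      linarith
    have h := hi (i + 1)
    push_cast at h
    rw [abs_of_nonneg (by nlinarith), abs_of_nonneg (by nlinarith)] at h
    nlinarith
  exact ⟨Int.csInf_mem hne hbdd, fun i hi => csInf_le hbdd hi⟩

/-! ### The algorithms

`K` is a field with embeddings `σ` into `ℝ` and `τ` into `ℚ_[p]`. -/

section Algorithms

variable {p : ℕ} [Fact p.Prime] {K : Type*} [Field K] (σ : K →+* ℝ) (τ : K →+* ℚ_[p])

/-- The step `p` at even indices and `1` at odd indices. -/
def step (p n : ℕ) : ℕ := if Even n then p else 1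

/-- For `s = p` this is `b^{(0)}(α) = m p + ⌊α_⟨p⟩⌋_p` and for `s = 1` it is
`b^{(1)}(α) = m + ⌊α_⟨p⟩⌋_p`, where `m` is the smallest among the integers `i` for which
`|α_∞ - i s - ⌊α_⟨p⟩⌋_p|` is minimal. -/
noncomputable def bCoeff (s : ℕ) (α : K) : ℚ :=
  (nearest (σ α - (padicFloor p (τ α) : ℝ)) s : ℚ) * (s : ℚ) + padicFloor p (τ α)

/-- `a^{(0)}(α)` for `s = p` and `a^{(1)}(α)` for `s = 1`. -/
noncomputable def aCoeff (s : ℕ) (α : K) : ℚ := bCoeff σ τ s (1 / α)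

/-- The map `T_{p,0}` for `s = p` and `T_{p,1}` for `s = 1`, to be applied to `α ≠ 0`. -/
noncomputable def T (s : ℕ) (α : K) : K := 1 / α - (aCoeff σ τ s α : K)

open Classical in
/-- The sequence `α_(1) = α`, `α_(n+1) = T_{p,0}(α_(n))` for even `n` and
`α_(n+1) = T_{p,1}(α_(n))` for odd `n`, which terminates once `α_(n) = 0`.
The value `none` means that `α_(n)` is not defined; in particular there is no `α_(0)`. -/
noncomputable def tSeq (α : K) : ℕ → Option K
  | 0 => none
  | 1 => some α
  | n + 2 => (tSeq α (n + 1)).bind fun β =>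
      if β = 0 then none else some (T σ τ (step p (n + 1)) β)

open Classical in
/-- The transformation `F_{p,0}` for `s = p` and `F_{p,1}` for `s = 1`; the value `none`
means that it is not defined at `α`. -/
noncomputable def F (s : ℕ) (α : K) : Option K :=
  if α - (bCoeff σ τ s α : K) = 0 then none else some (1 / (α - (bCoeff σ τ s α : K)))

/-- The sequence `α_0 = α`, `α_{n+1} = F_{p,0}(α_n)` for even `n` and
`α_{n+1} = F_{p,1}(α_n)` for odd `n`, which halts when the next term is not defined. -/
noncomputable def fSeq (α : K) : ℕ → Option K
  | 0 => some α
  | n + 1 => (fSeq α n).bind (F σ τ (step p n))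

/-- Property `I`: `α_∞ ∈ (-p/2, p/2]` and `v_p(α_⟨p⟩) > 0` (with `v_p(0) = ∞`). -/
def PropertyI (α : K) : Prop :=
  σ α ∈ Set.Ioc (-(p : ℝ) / 2) ((p : ℝ) / 2) ∧ 0 < Padic.addValuation (τ α)

end Algorithms

end PadicRealCF

/-!
Both sequences come down to a recurrence `x (n + 1) = 1 / x n - t n` with `t n ∈ ℤ[1/2]` in which
every term is a `2`-adic integer and the real absolute values are alternately at most `1` and at
most `1 / 2`. For `T` this is `tSeq_succ_eq_orbit`; for `F` the numbers `α_n - b(α_n)`, the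
inverses of the `α_{n+1}`, form such a sequence (`fSeq_succ_eq_inv_orbit`). No term is rational,
so neither sequence terminates.

As in Lagrange's theorem on periodic continued fractions, `x n` is a root of some
`a X² + b X + c` with coefficients in `ℤ[1/2]`, and the derivative `2 a x + b` at that root stays
equal to a fixed `d` up to sign. The next leading coefficient is `c = a x² ∓ d x`, so that
boundedness of the `x n` at both places makes the leading coefficients bounded at both places
(`BoundedRoot.inv_sub`): if `M` bounds `|a|` and `|d|` at the real place, the successive bounds are
`M`, `2 M`, `2 M / 4 + M / 2 = M`, and so on, while the ultrametric inequality settles the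
`2`-adic place. Then all coefficients are bounded as well. Since `ℤ[1/2]` is discrete in
`ℝ × ℚ_[2]` (`finite_dyadic_bounded`), only finitely many polynomials, hence finitely many `x n`,
occur (`finite_boundedRoot`), and two terms with even index agree.
-/

namespace PadicRealCF

/-! ### Dyadic rationals -/

/-- The ring `ℤ[1/2]` of dyadic rationals. -/
def dyadic : Subring ℚ where
  carrier := {q | ∃ (j : ℕ) (z : ℤ), q * 2 ^ j = z}
  mul_mem' := by
    rintro a b ⟨i, y, hy⟩ ⟨j, z, hz⟩
    exact ⟨i + j, y * z, by push_cast; rw [← hy, ← hz]; ring⟩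
  one_mem' := ⟨0, 1, by simp⟩
  add_mem' := by
    rintro a b ⟨i, y, hy⟩ ⟨j, z, hz⟩
    exact ⟨i + j, y * 2 ^ j + z * 2 ^ i, by push_cast; rw [← hy, ← hz]; ring⟩
  zero_mem' := ⟨0, 0, by simp⟩
  neg_mem' := by
    rintro a ⟨i, y, hy⟩
    exact ⟨i, -y, by push_cast; rw [← hy]; ring⟩

theorem two_zpow_mem_dyadic (n : ℤ) : (2 : ℚ) ^ n ∈ dyadic := by
  obtain ⟨k, rfl | rfl⟩ := n.eq_nat_or_neg
  · exact ⟨0, 2 ^ k, by simp⟩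
  · exact ⟨k, 1, by simp⟩

theorem padicFloor_mem_dyadic (x : ℚ_[2]) : padicFloor 2 x ∈ dyadic := by
  refine sum_mem fun n _ => mul_mem (natCast_mem _ _) ?_
  exact_mod_cast two_zpow_mem_dyadic n

/-- `ℤ[1/2]` is discrete in `ℝ × ℚ_[2]`. -/
theorem finite_dyadic_bounded (R : ℝ) :
    {q : ℚ | q ∈ dyadic ∧ |(q : ℝ)| ≤ R ∧ ‖(q : ℚ_[2])‖ ≤ R}.Finite := by
  obtain ⟨k, hk⟩ := pow_unbounded_of_one_lt R (one_lt_two (α := ℝ))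
  obtain ⟨N, hN⟩ := exists_nat_ge (R * 2 ^ k)
  refine ((Set.finite_Icc (-(N : ℤ)) N).image fun z : ℤ => (z : ℚ) / 2 ^ k).subset ?_
  rintro q ⟨⟨j, z, hz⟩, hR, h2⟩
  -- `2 ^ k * q` is a `2`-adic integer, hence an integer.
  have hdvd : ((2 : ℕ) ^ j : ℤ) ∣ z * 2 ^ k := by
    rw [← Nat.cast_pow, Nat.cast_pow, ← Padic.norm_int_le_pow_iff_dvd]
    have hzq : ((z * 2 ^ k : ℤ) : ℚ_[2]) = q * 2 ^ k * 2 ^ j := by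
      have := congrArg (Rat.cast : ℚ → ℚ_[2]) hz
      push_cast at this ⊢
      rw [← this]
      ring
    have hn : ‖(2 : ℚ_[2])‖ = 2⁻¹ := by simpa using Padic.norm_p (p := 2)
    rw [hzq, norm_mul, norm_mul, norm_pow, norm_pow, hn, zpow_neg, zpow_natCast]
    have h1 : ‖(q : ℚ_[2])‖ * 2⁻¹ ^ k ≤ 1 := by
      rw [inv_pow, ← div_eq_mul_inv, div_le_one (by positivity)]
      exact h2.trans hk.le
    calc _ ≤ (1 : ℝ) * 2⁻¹ ^ j := by gcongr
      _ = _ := by simp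
  obtain ⟨w, hw⟩ := hdvd
  have hqw : q * 2 ^ k = w := by
    have h := congrArg (Int.cast : ℤ → ℚ) hw
    push_cast at h
    rw [← hz] at h
    have h2j : (2 : ℚ) ^ j ≠ 0 := by positivity
    apply mul_left_cancel₀ h2j
    rw [← h]
    ring
  have hwN : |(w : ℝ)| ≤ N := by
    have h := congrArg (Rat.cast : ℚ → ℝ) hqw
    push_cast at h
    rw [← h, abs_mul, abs_of_pos (by positivity : (0 : ℝ) < 2 ^ k)]
    exact le_trans (by gcongr) hN
  refine ⟨w, ?_, ?_⟩
  · rw [abs_le] at hwN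
    exact ⟨by exact_mod_cast hwN.1, by exact_mod_cast hwN.2⟩
  · simp only
    rw [← hqw]
    field_simp

/-! ### The partial quotients approximate at both places -/

theorem norm_sub_le_max (x y : ℚ_[2]) : ‖x - y‖ ≤ max ‖x‖ ‖y‖ := by
  simpa [sub_eq_add_neg] using Padic.nonarchimedean x (-y)

theorem norm_sub_padicFloor_le (x : ℚ_[2]) : ‖x - (padicFloor 2 x : ℚ_[2])‖ ≤ 1 := by
  have h := hasSum_digit 2 x
  have hfl : (padicFloor 2 x : ℚ_[2]) =
      ∑ n ∈ Finset.Icc x.valuation 0, (digit 2 x n : ℚ_[2]) * ((2 : ℕ) : ℚ_[2]) ^ n := by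
    simp [padicFloor]
  refine isClosed_le (continuous_norm.comp (continuous_sub_right _)) continuous_const
    |>.mem_of_tendsto h ?_
  filter_upwards [Filter.eventually_ge_atTop (Finset.Icc x.valuation 0)] with s hs
  simp only [Function.comp]
  rw [hfl, ← Finset.sum_sdiff hs, add_sub_cancel_right]
  refine IsUltrametricDist.norm_sum_le_of_forall_le_of_nonneg zero_le_one fun n hn => ?_
  rw [Finset.mem_sdiff, Finset.mem_Icc, not_and_or, not_le, not_le] at hn
  rcases hn.2 with hlt | hpos
  · simp [digit, hlt]
  · rw [norm_mul, Padic.norm_p_zpow]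
    have h1 : ‖((digit 2 x n : ℕ) : ℚ_[2])‖ ≤ 1 := by
      exact_mod_cast Padic.norm_int_le_one (p := 2) (digit 2 x n : ℤ)
    refine mul_le_one₀ h1 (by positivity) (zpow_le_one_of_nonpos₀ (by norm_num) (by omega))

variable {K : Type*} [Field K] (σ : K →+* ℝ) (τ : K →+* ℚ_[2])

theorem bCoeff_mem_dyadic (s : ℕ) (α : K) : bCoeff σ τ s α ∈ dyadic :=
  add_mem (mul_mem (intCast_mem _ _) (natCast_mem _ _)) (padicFloor_mem_dyadic _)

theorem norm_sub_bCoeff_le (s : ℕ) (α : K) : ‖τ α - (bCoeff σ τ s α : ℚ_[2])‖ ≤ 1 := by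
  set m := nearest (σ α - (padicFloor 2 (τ α) : ℝ)) s
  have e : τ α - (bCoeff σ τ s α : ℚ_[2]) =
      (τ α - (padicFloor 2 (τ α) : ℚ_[2])) - ((m * s : ℤ) : ℚ_[2]) := by
    simp only [bCoeff]
    push_cast
    ring
  rw [e]
  exact (norm_sub_le_max _ _).trans
    (max_le (norm_sub_padicFloor_le _) (Padic.norm_int_le_one _))

theorem abs_sub_bCoeff_le {s : ℕ} (hs : 0 < s) (α : K) :
    |σ α - (bCoeff σ τ s α : ℝ)| ≤ s / 2 := by
  set y : ℝ := σ α - (padicFloor 2 (τ α) : ℝ) with hy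
  have hs' : (0 : ℝ) < s := by exact_mod_cast hs
  have e : σ α - (bCoeff σ τ s α : ℝ) = y - nearest y s * s := by
    simp only [bCoeff, hy]
    push_cast
    ring
  rw [e]
  refine ((isLeast_nearest y hs).1 (round (y / s))).trans ?_
  have h := abs_sub_round (y / s)
  have e' : y - round (y / s) * s = (y / s - round (y / s)) * s := by
    field_simp
  rw [e', abs_mul, abs_of_pos hs']
  nlinarith

/-! ### Quadratic equations along the algorithm -/

theorem exists_int_quadratic [CharZero K] (hK : Module.finrank ℚ K = 2) {x : K}
    (hx : x ∉ Set.range (algebraMap ℚ K)) :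
    ∃ a b c : ℤ, a ≠ 0 ∧ (a : K) * x ^ 2 + b * x + c = 0 := by
  have : Module.Finite ℚ K := Module.finite_of_finrank_pos (by omega)
  have hdep : ¬ LinearIndependent ℤ ![1, x, x ^ 2] := by
    rw [LinearIndependent.iff_fractionRing ℤ ℚ]
    intro h
    have := h.fintype_card_le_finrank
    rw [hK] at this
    simp at this
  rw [Fintype.not_linearIndependent_iff] at hdep
  obtain ⟨g, hg, i, hi⟩ := hdep
  simp only [Fin.sum_univ_three, zsmul_eq_mul, Matrix.cons_val] at hg
  refine ⟨g 2, g 1, g 0, fun h2 => ?_, by rw [← hg]; ring⟩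
  rw [h2] at hg
  by_cases h1 : g 1 = 0
  · simp only [h1, Int.cast_zero, zero_mul, add_zero, mul_one, Int.cast_eq_zero] at hg
    fin_cases i <;> simp_all
  · refine hx ⟨-(g 0 : ℚ) / g 1, ?_⟩
    have h1' : (g 1 : K) ≠ 0 := by exact_mod_cast h1
    simp only [map_div₀, map_neg, map_intCast]
    rw [div_eq_iff h1']
    linear_combination -hg

/-- `x` is a root of a quadratic polynomial over `ℤ[1/2]` whose derivative at `x` is `d` or `-d`
and whose leading coefficient is bounded by `R` at the real place and by `R'` at the `2`-adic
place. -/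
def BoundedRoot (d : K) (R R' : ℝ) (x : K) : Prop :=
  ∃ a ∈ dyadic, ∃ b ∈ dyadic, ∃ c ∈ dyadic, a ≠ 0 ∧ (a : K) * x ^ 2 + b * x + c = 0 ∧
    (2 * a * x + b = d ∨ 2 * a * x + b = -d) ∧ |(a : ℝ)| ≤ R ∧ ‖(a : ℚ_[2])‖ ≤ R'

variable [CharZero K]

/-- The polynomial of `1 / x - t` has the constant term of the polynomial of `x` as its leading
coefficient and the opposite derivative at its root. -/
theorem BoundedRoot.inv_sub {d : K} {R R' r S : ℝ} {x : K} {t : ℚ}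
    (h : BoundedRoot d R R' x) (hx : x ∉ Set.range (algebraMap ℚ K)) (ht : t ∈ dyadic)
    (hσ : |σ x| ≤ r) (hτ : ‖τ x‖ ≤ 1) (hS : R * r ^ 2 + |σ d| * r ≤ S) (hd : ‖τ d‖ ≤ R') :
    BoundedRoot d S R' (1 / x - t) := by
  obtain ⟨a, ha, b, hb, c, hc, ha0, heq, hder, hR, hR'⟩ := h
  have hx0 : x ≠ 0 := fun h => hx ⟨0, by simp [h]⟩
  have haK : (a : K) ≠ 0 := by exact_mod_cast ha0
  have hder' : ∃ e : K, 2 * a * x + b = e ∧ (e = d ∨ e = -d) := ⟨_, rfl, hder⟩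
  obtain ⟨e, he, hed⟩ := hder'
  -- The other root of the polynomial of `x` is `x - e / a`, whence `c`.
  have hcx : (c : K) = a * x ^ 2 - e * x := by linear_combination heq - x * he
  have h1 : |σ e| = |σ d| := by rcases hed with rfl | rfl <;> simp
  have h2 : ‖τ e‖ = ‖τ d‖ := by rcases hed with rfl | rfl <;> simp
  refine ⟨c, hc, b + 2 * t * c,
    add_mem hb (mul_mem (mul_mem (ofNat_mem _ 2) ht) hc),
    a + b * t + c * t ^ 2, add_mem (add_mem ha (mul_mem hb ht)) (mul_mem hc (pow_mem ht 2)),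
    ?_, ?_, ?_, ?_, ?_⟩
  · rintro rfl
    refine hx ⟨-b / a, ?_⟩
    simp only [map_div₀, map_neg, eq_ratCast]
    rw [div_eq_iff haK]
    apply mul_left_cancel₀ hx0
    push_cast at heq
    linear_combination -heq
  · push_cast
    field_simp
    linear_combination heq
  · have : 2 * (c : K) * (1 / x - t) + ((b + 2 * t * c : ℚ) : K) = -e := by
      push_cast
      field_simp
      linear_combination 2 * heq - x * he
    rw [this]
    rcases hed with rfl | rfl <;> simp
  · have hcσ : (c : ℝ) = a * σ x ^ 2 - σ e * σ x := by
      have := congrArg σ hcx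
      simpa using this
    have hR0 : 0 ≤ R := (abs_nonneg _).trans hR
    calc |(c : ℝ)| ≤ |(a : ℝ)| * |σ x| ^ 2 + |σ e| * |σ x| := by
          rw [hcσ, ← abs_pow, ← abs_mul, ← abs_mul]
          exact abs_sub _ _
      _ ≤ R * r ^ 2 + |σ d| * r := by rw [h1]; gcongr
      _ ≤ S := hS
  · have hcτ : (c : ℚ_[2]) = a * τ x ^ 2 - τ e * τ x := by
      have := congrArg τ hcx
      simpa using this
    rw [hcτ]
    refine (norm_sub_le_max _ _).trans (max_le ?_ ?_)
    · rw [norm_mul, norm_pow]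
      exact (mul_le_of_le_one_right (norm_nonneg _) (pow_le_one₀ (norm_nonneg _) hτ)).trans hR'
    · rw [norm_mul, h2]
      exact (mul_le_of_le_one_right (norm_nonneg _) hτ).trans hd

/-- A bounded root that is itself bounded at both places has all its coefficients in a finite
subset of `ℤ[1/2]`. -/
theorem finite_boundedRoot (d : K) (R R' : ℝ) :
    {x : K | BoundedRoot d R R' x ∧ |σ x| ≤ 1 ∧ ‖τ x‖ ≤ 1}.Finite := by
  set N : ℝ := |σ d| + 2 * R + ‖τ d‖ + R' with hN
  set D := {q : ℚ | q ∈ dyadic ∧ |(q : ℝ)| ≤ N ∧ ‖(q : ℚ_[2])‖ ≤ N}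
  have hD : D.Finite := finite_dyadic_bounded N
  let P : ℚ × ℚ × ℚ → Polynomial K := fun v =>
    .C (v.1 : K) * .X ^ 2 + .C (v.2.1 : K) * .X + .C (v.2.2 : K)
  refine ((hD.prod (hD.prod hD)).biUnion fun v _ => (P v).rootSet_finite K).subset ?_
  rintro x ⟨⟨a, ha, b, hb, c, hc, ha0, heq, hder, hR, hR'⟩, hσ, hτ⟩
  have hder' : ∃ e : K, 2 * a * x + b = e ∧ (e = d ∨ e = -d) := ⟨_, rfl, hder⟩
  obtain ⟨e, he, hed⟩ := hder'
  have h1 : |σ e| = |σ d| := by rcases hed with rfl | rfl <;> simp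
  have h2 : ‖τ e‖ = ‖τ d‖ := by rcases hed with rfl | rfl <;> simp
  have hcx : (c : K) = a * x ^ 2 - e * x := by linear_combination heq - x * he
  have hbx : (b : K) = e - 2 * a * x := by linear_combination he
  have hR0 : 0 ≤ R := (abs_nonneg _).trans hR
  have hR0' : 0 ≤ R' := (norm_nonneg _).trans hR'
  have hd1 := abs_nonneg (σ d)
  have hd2 := norm_nonneg (τ d)
  have haσ : |(a : ℝ)| * |σ x| ≤ R := (mul_le_of_le_one_right (abs_nonneg _) hσ).trans hR
  have haτ : ‖(a : ℚ_[2])‖ * ‖τ x‖ ≤ R' := (mul_le_of_le_one_right (norm_nonneg _) hτ).trans hR'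
  have haD : a ∈ D := ⟨ha, by linarith, by linarith⟩
  have hbD : b ∈ D := by
    refine ⟨hb, ?_, ?_⟩
    · have hbσ : (b : ℝ) = σ e - 2 * (a * σ x) := by
        have := congrArg σ hbx
        simpa [mul_assoc, map_ofNat] using this
      have := abs_sub (σ e) (2 * (a * σ x))
      rw [abs_mul, abs_mul, abs_two] at this
      rw [hbσ]
      linarith
    · have hbτ : (b : ℚ_[2]) = τ e - ((2 : ℤ) : ℚ_[2]) * (a * τ x) := by
        have := congrArg τ hbx
        simpa [mul_assoc, map_ofNat] using this
      have h := norm_sub_le (τ e) (((2 : ℤ) : ℚ_[2]) * (a * τ x))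
      rw [norm_mul, norm_mul] at h
      have h' := mul_le_of_le_one_left
        (mul_nonneg (norm_nonneg (a : ℚ_[2])) (norm_nonneg (τ x))) (Padic.norm_int_le_one (p := 2) 2)
      rw [hbτ]
      linarith
  have hcD : c ∈ D := by
    refine ⟨hc, ?_, ?_⟩
    · have hcσ : (c : ℝ) = a * σ x * σ x - σ e * σ x := by
        have := congrArg σ hcx
        simpa [sq, mul_assoc] using this
      have h := abs_sub (a * σ x * σ x) (σ e * σ x)
      rw [abs_mul, abs_mul, abs_mul] at h
      have h3 := mul_le_of_le_one_right (mul_nonneg (abs_nonneg (a : ℝ)) (abs_nonneg (σ x))) hσ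
      have h4 := mul_le_of_le_one_right (abs_nonneg (σ e)) hσ
      rw [hcσ]
      linarith
    · have hcτ : (c : ℚ_[2]) = a * τ x * τ x - τ e * τ x := by
        have := congrArg τ hcx
        simpa [sq, mul_assoc] using this
      have h := norm_sub_le (a * τ x * τ x) (τ e * τ x)
      rw [norm_mul, norm_mul, norm_mul] at h
      have h3 := mul_le_of_le_one_right
        (mul_nonneg (norm_nonneg (a : ℚ_[2])) (norm_nonneg (τ x))) hτ
      have h4 := mul_le_of_le_one_right (norm_nonneg (τ e)) hτ
      rw [hcτ]
      linarith
  refine Set.mem_biUnion (x := (a, b, c)) ⟨haD, hbD, hcD⟩ ?_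
  rw [Polynomial.mem_rootSet']
  constructor
  · have haK : (a : K) ≠ 0 := by exact_mod_cast ha0
    simp only [P, Polynomial.map_id, Algebra.algebraMap_self]
    intro h0
    have := Polynomial.leadingCoeff_quadratic (b := (b : K)) (c := (c : K)) haK
    rw [h0, Polynomial.leadingCoeff_zero] at this
    exact haK this.symm
  · simpa [P] using heq

/-- The common core of both statements: a sequence `x (n + 1) = 1 / x n - t n` with
`t n ∈ ℤ[1/2]` that is bounded as below takes the same value at two indices of equal parity. -/
theorem exists_eq_of_recurrence (hK : Module.finrank ℚ K = 2) (x : ℕ → K) (t : ℕ → ℚ)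
    (hx : ∀ n, x n ∉ Set.range (algebraMap ℚ K)) (ht : ∀ n, t n ∈ dyadic)
    (hrec : ∀ n, x (n + 1) = 1 / x n - t n) (heven : ∀ k, |σ (x (2 * k))| ≤ 1)
    (hodd : ∀ k, |σ (x (2 * k + 1))| ≤ 1 / 2) (hτ : ∀ n, ‖τ (x n)‖ ≤ 1) :
    ∃ n₁ n₂ : ℕ, n₁ < n₂ ∧ n₁ ≡ n₂ [MOD 2] ∧ x n₁ = x n₂ := by
  obtain ⟨a, b, c, ha, heq⟩ := exists_int_quadratic hK (hx 0)
  set d : K := 2 * a * x 0 + b with hd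
  set M : ℝ := max |(a : ℝ)| |σ d| with hM
  set M' : ℝ := max ‖(a : ℚ_[2])‖ ‖τ d‖ with hM'
  have hdM : |σ d| ≤ M := le_max_right _ _
  -- The real bound is `M` at even indices and `2 * M` at odd ones: the step from an even index
  -- gives `M + M`, the step from an odd one `2 * M / 4 + M / 2`.
  have hall : ∀ k, BoundedRoot d M M' (x (2 * k)) := by
    intro k
    induction k with
    | zero =>
      exact ⟨a, intCast_mem _ _, b, intCast_mem _ _, c, intCast_mem _ _, by exact_mod_cast ha,
        by simpa using heq, by left; simp [hd], by simp [hM], by simp [hM']⟩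
    | succ k ih =>
      have h1 : BoundedRoot d (2 * M) M' (x (2 * k + 1)) := by
        rw [hrec]
        exact ih.inv_sub σ τ (hx _) (ht _) (heven k) (hτ _) (by linarith) (le_max_right _ _)
      have h2 : BoundedRoot d M M' (x (2 * k + 1 + 1)) := by
        rw [hrec]
        exact h1.inv_sub σ τ (hx _) (ht _) (hodd k) (hτ _) (by linarith) (le_max_right _ _)
      exact h2
  have hmem : ∀ k, x (2 * k) ∈ {y : K | BoundedRoot d M M' y ∧ |σ y| ≤ 1 ∧ ‖τ y‖ ≤ 1} :=
    fun k => ⟨hall k, heven k, hτ _⟩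
  obtain ⟨k, l, hkl, h⟩ := Set.Finite.exists_lt_map_eq_of_forall_mem hmem
    (finite_boundedRoot σ τ d M M')
  exact ⟨2 * k, 2 * l, by omega, by simp [Nat.ModEq], h⟩

/-! ### The orbits -/

theorem inv_sub_ratCast_notMem {x : K} (hx : x ∉ Set.range (algebraMap ℚ K)) (t : ℚ) :
    1 / x - t ∉ Set.range (algebraMap ℚ K) := by
  rintro ⟨q, hq⟩
  rw [eq_ratCast] at hq
  refine hx ⟨1 / (q + t), ?_⟩
  simp [hq]

/-- The orbit of `β` under `T_{2,1}`, `T_{2,0}`, `T_{2,1}`, …, with index starting at `0`. -/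
noncomputable def orbit (β : K) : ℕ → K
  | 0 => β
  | n + 1 => T σ τ (step 2 (n + 1)) (orbit β n)

theorem orbit_notMem {β : K} (hβ : β ∉ Set.range (algebraMap ℚ K)) (n : ℕ) :
    orbit σ τ β n ∉ Set.range (algebraMap ℚ K) := by
  induction n with
  | zero => exact hβ
  | succ n ih => exact inv_sub_ratCast_notMem ih _

theorem orbit_ne_zero {β : K} (hβ : β ∉ Set.range (algebraMap ℚ K)) (n : ℕ) :
    orbit σ τ β n ≠ 0 := fun h => orbit_notMem σ τ hβ n ⟨0, by simp [h]⟩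

theorem abs_T_le {s : ℕ} (hs : 0 < s) (β : K) : |σ (T σ τ s β)| ≤ s / 2 := by
  have h := abs_sub_bCoeff_le σ τ hs (1 / β)
  simpa [T, aCoeff] using h

theorem norm_T_le (s : ℕ) (β : K) : ‖τ (T σ τ s β)‖ ≤ 1 := by
  have h := norm_sub_bCoeff_le σ τ s (1 / β)
  simpa [T, aCoeff] using h

theorem exists_orbit_eq (hK : Module.finrank ℚ K = 2) {β : K}
    (hβ : β ∉ Set.range (algebraMap ℚ K)) (hσ : |σ β| ≤ 1) (hτ : ‖τ β‖ ≤ 1) :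
    ∃ n₁ n₂ : ℕ, n₁ < n₂ ∧ n₁ ≡ n₂ [MOD 2] ∧ orbit σ τ β n₁ = orbit σ τ β n₂ := by
  refine exists_eq_of_recurrence σ τ hK (orbit σ τ β)
    (fun n => aCoeff σ τ (step 2 (n + 1)) (orbit σ τ β n)) (orbit_notMem σ τ hβ)
    (fun n => bCoeff_mem_dyadic σ τ _ _) (fun n => rfl) ?_ ?_ ?_
  · rintro (_ | k)
    · exact hσ
    · have h := abs_T_le σ τ two_pos (orbit σ τ β (2 * k + 1))
      have hs : step 2 (2 * k + 1 + 1) = 2 := if_pos ⟨k + 1, by ring⟩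
      show |σ (T σ τ (step 2 (2 * k + 1 + 1)) _)| ≤ 1
      rw [hs]
      simpa using h
  · intro k
    have h := abs_T_le σ τ one_pos (orbit σ τ β (2 * k))
    have hs : step 2 (2 * k + 1) = 1 := if_neg (by simp)
    show |σ (T σ τ (step 2 (2 * k + 1)) _)| ≤ 1 / 2
    rw [hs]
    simpa using h
  · rintro (_ | n)
    · exact hτ
    · exact norm_T_le σ τ _ _

theorem tSeq_succ_eq_orbit {β : K} (hβ : β ∉ Set.range (algebraMap ℚ K)) (n : ℕ) :
    tSeq σ τ β (n + 1) = some (orbit σ τ β n) := by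
  induction n with
  | zero => rfl
  | succ n ih => simp [tSeq, ih, orbit_ne_zero σ τ hβ n, orbit]

theorem sub_bCoeff_notMem {α : K} (hα : α ∉ Set.range (algebraMap ℚ K)) (s : ℕ) :
    α - (bCoeff σ τ s α : K) ∉ Set.range (algebraMap ℚ K) := by
  rintro ⟨q, hq⟩
  exact hα ⟨q + bCoeff σ τ s α, by rw [map_add, hq]; simp⟩

/-- `α_n - b(α_n) = 1 / α_{n+1}` turns the iteration of `F` into that of `T`. -/
theorem fSeq_succ_eq_inv_orbit {α : K} (hα : α ∉ Set.range (algebraMap ℚ K)) (n : ℕ) :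
    fSeq σ τ α (n + 1) = some (1 / orbit σ τ (α - (bCoeff σ τ 2 α : K)) n) := by
  have hβ := sub_bCoeff_notMem σ τ hα 2
  induction n with
  | zero =>
    have h0 := orbit_ne_zero σ τ hβ 0
    simp only [orbit] at h0
    simp [fSeq, step, F, orbit, h0]
  | succ n ih =>
    have h0 := orbit_ne_zero σ τ hβ (n + 1)
    simp only [orbit, T, aCoeff] at h0
    rw [fSeq, ih, Option.bind_some, F, if_neg h0]
    rfl

end PadicRealCF

theorem theorem3p20 {K : Type*} [Field K] [NumberField K]
    (hK : Module.finrank ℚ K = 2) (σ : K →+* ℝ) (τ : K →+* ℚ_[2]) :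
    (∀ α : K, α ∉ Set.range (algebraMap ℚ K) → PadicRealCF.PropertyI σ τ α →
      ∃ n₁ n₂ : ℕ, 1 ≤ n₁ ∧ n₁ < n₂ ∧ n₁ ≡ n₂ [MOD 2] ∧
        ∃ β : K, PadicRealCF.tSeq σ τ α n₁ = some β ∧ PadicRealCF.tSeq σ τ α n₂ = some β) ∧
    (∀ α : K, α ∉ Set.range (algebraMap ℚ K) →
      ∃ n₁ n₂ : ℕ, n₁ < n₂ ∧ n₁ ≡ n₂ [MOD 2] ∧
        ∃ β : K, PadicRealCF.fSeq σ τ α n₁ = some β ∧ PadicRealCF.fSeq σ τ α n₂ = some β) := by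
  constructor
  · rintro α hα ⟨hσ, hτ⟩
    have hσ' : |σ α| ≤ 1 := by
      rw [Set.mem_Ioc] at hσ
      norm_num at hσ
      exact abs_le.2 ⟨hσ.1.le, hσ.2⟩
    have hτ' : ‖τ α‖ ≤ 1 := by
      have h0 : τ α ≠ 0 := by
        rw [Ne, map_eq_zero]
        rintro rfl
        exact hα ⟨0, by simp⟩
      rw [Padic.addValuation.apply h0] at hτ
      exact (Padic.norm_le_one_iff_val_nonneg _).2 (by exact_mod_cast hτ.le)
    obtain ⟨n₁, n₂, hlt, hmod, h⟩ := PadicRealCF.exists_orbit_eq σ τ hK hα hσ' hτ'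
    refine ⟨n₁ + 1, n₂ + 1, by omega, by omega, hmod.add_right 1, _,
      PadicRealCF.tSeq_succ_eq_orbit σ τ hα n₁, ?_⟩
    rw [PadicRealCF.tSeq_succ_eq_orbit σ τ hα, h]
  · intro α hα
    set β := α - (PadicRealCF.bCoeff σ τ 2 α : K) with hβdef
    have hβ : β ∉ Set.range (algebraMap ℚ K) := PadicRealCF.sub_bCoeff_notMem σ τ hα 2
    have hσ : |σ β| ≤ 1 := by
      simpa [hβdef] using PadicRealCF.abs_sub_bCoeff_le σ τ two_pos α
    have hτ : ‖τ β‖ ≤ 1 := by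
      simpa [hβdef] using PadicRealCF.norm_sub_bCoeff_le σ τ 2 α
    obtain ⟨n₁, n₂, hlt, hmod, h⟩ := PadicRealCF.exists_orbit_eq σ τ hK hβ hσ hτ
    refine ⟨n₁ + 1, n₂ + 1, by omega, hmod.add_right 1, _,
      PadicRealCF.fSeq_succ_eq_inv_orbit σ τ hα n₁, ?_⟩
    rw [PadicRealCF.fSeq_succ_eq_inv_orbit σ τ hα, ← hβdef, h]
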